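/- Let $\varphi$ be the Fibonacci substitution $0\mapsto 01$, $1\mapsto 0$, and let $(X_\varphi,\sigma)$ be the Fibonacci system, i.e. the closure in $\{0,1\}^{\mathbb Z}$ of the orbit under the shift $\sigma$ of the two-sided fixed point $\dots 01001001\cdot 0100101001\dots$ of $\varphi^2$ (the word that has all $\varphi^{m}(0)$ as prefixes of its right half and all $\varphi^{2m}(1)$ as suffixes of its left half). Let $F_1=F_2=1$, $F_{n+1}=F_n+F_{n-1}$ be the Fibonacci numbers. Let $A$ be a finite alphabet and let $Y\subseteq A^{\mathbb Z}$ be any non-empty subshift (a closed, shift-invariant set). Then $(Y,\sigma)$ is topologically conjugate to $(X_\varphi,\sigma)$ (that is, there is a homeomorphism $Y\to X_\varphi$ commuting with the shifts) if and only if there exist $n\ge 3$ and two words $B_0$ and $B_1$ over $A$ of lengths $F_n$ and $F_{n-1}$, respectively, such that 1. every $y\in Y$ is a bi-infinite concatenation $\cdots B_{x_{-1}}B_{x_0}B_{x_1}\cdots$ of $B_0$ and $B_1$, for some $x=(x_k)_{k\in\mathbb Z}\in\{0,1\}^{\mathbb Z}$ (the $0$-th coordinate of $y$ may lie anywhere inside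 a block), and 2. whenever $y\in Y$ is written as such a concatenation $\cdots B_{x_{-1}}B_{x_0}B_{x_1}\cdots$ with $x\in\{0,1\}^{\mathbb Z}$, one has $x\in X_\varphi$. -/

import Mathlib

namespace FibonacciClass

open SymbolicDynamics.FullShift

/-! Two-sided subshifts are Mathlib's `Subshift A ℤ`: closed subsets of `ℤ → A` (product topology)
that are invariant under `shift g` for every `g : ℤ`, where `shift g x h = x (g + h)`. -/

/-- The left shift `σ` as a self-map of a two-sided subshift. -/
def shiftMap {A : Type*} [TopologicalSpace A] (X : Subshift A ℤ) (x : X.carrier) : X.carrier :=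
  ⟨shift (1 : ℤ) (x : ℤ → A), X.mapsTo 1 x.2⟩

/-- Topological conjugacy: a homeomorphism `ψ : X → Y` with `ψ σ = σ ψ`. -/
def TopConjugate {A B : Type*} [TopologicalSpace A] [TopologicalSpace B]
    (X : Subshift A ℤ) (Y : Subshift B ℤ) : Prop :=
  ∃ ψ : X.carrier ≃ₜ Y.carrier, Function.Semiconj ψ (shiftMap X) (shiftMap Y)

/-- The Fibonacci substitution on letters: `0 ↦ 01`, `1 ↦ 0`. -/
def fibLetter (a : Fin 2) : List (Fin 2) := if a = 0 then [0, 1] else [0]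

/-- The Fibonacci substitution `φ` on words. -/
def fibSubst (w : List (Fin 2)) : List (Fin 2) := w.flatMap fibLetter

theorem fibSubst_iterate_append (n : ℕ) (u v : List (Fin 2)) :
    fibSubst^[n] (u ++ v) = fibSubst^[n] u ++ fibSubst^[n] v := by
  induction n generalizing u v with
  | zero => rfl
  | succ n ih =>
    rw [Function.iterate_succ_apply, Function.iterate_succ_apply, Function.iterate_succ_apply, ← ih]
    simp [fibSubst]

theorem length_fibSubst_iterate (n : ℕ) :
    (fibSubst^[n] [0]).length = Nat.fib (n + 2) ∧ (fibSubst^[n] [1]).length = Nat.fib (n + 1) := by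
  induction n with
  | zero => simp
  | succ n ih =>
    have h0 : fibSubst [0] = [0] ++ [1] := rfl
    have h1 : fibSubst [1] = [0] := rfl
    constructor
    · rw [Function.iterate_succ_apply, h0, fibSubst_iterate_append, List.length_append, ih.1, ih.2]
      exact ((Nat.fib_add_two (n := n + 1)).trans (Nat.add_comm _ _)).symm
    · rw [Function.iterate_succ_apply, h1, ih.1]

theorem lt_length_zero (m : ℕ) : m < (fibSubst^[m] [0]).length := by
  rw [(length_fibSubst_iterate m).1]
  have := Nat.le_fib_add_one (m + 2)
  omega

theorem lt_length_one (m : ℕ) : m < ((fibSubst^[2 * m] [1]).reverse).length := by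
  rw [List.length_reverse, (length_fibSubst_iterate (2 * m)).2]
  rcases m with _ | m
  · simp
  · have := Nat.le_fib_add_one (2 * (m + 1) + 1)
    omega

/-- The two-sided fixed point `…01001001 · 0100101001…` of `φ²`. Its right half has all words
`φ ^ m (0)` as prefixes, its left half (read at positions `…, -2, -1`) has all words
`φ ^ (2 * m) (1)` as suffixes; `m` iterations are long enough to determine the entries at
positions `m` and `-1 - m`. -/
def fibPoint : ℤ → Fin 2
  | Int.ofNat m => (fibSubst^[m] [0])[m]'(lt_length_zero m)
  | Int.negSucc m => ((fibSubst^[2 * m] [1]).reverse)[m]'(lt_length_one m)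

/-- The Fibonacci system `X_φ`: the closure of the orbit of `fibPoint` under the shift. -/
def fibSystem : Subshift (Fin 2) ℤ where
  carrier := closure (Set.range fun g : ℤ => shift g fibPoint)
  isClosed := isClosed_closure
  mapsTo g := by
    refine Set.MapsTo.closure ?_ (continuous_shift g)
    rintro _ ⟨h, rfl⟩
    exact ⟨h + g, shift_add h g fibPoint⟩

/-- `y` is the concatenation `⋯ B_{x_{-1}} B_{x_0} B_{x_1} ⋯`. The `k`-th block occupies the
positions `s k, …, s (k + 1) - 1` of `y`; the origin of `y` may lie anywhere in a block. -/
def IsConcatenation {A : Type*} (B : Fin 2 → List A) (x : ℤ → Fin 2) (y : ℤ → A) : Prop :=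
  ∃ s : ℤ → ℤ, ∀ k : ℤ, s (k + 1) = s k + ((B (x k)).length : ℤ) ∧
    ∀ (i : ℕ) (hi : i < (B (x k)).length), y (s k + (i : ℤ)) = (B (x k))[i]

end FibonacciClass

namespace FibonacciClass

open SymbolicDynamics.FullShift

/-! Sufficiency: pair each `y` in `Y` with the binary sequence that has the same cuts but is filled
with the words `φ ^ (n - 2) (a)`, whose lengths are those of the blocks. These pairs form a compact
shift-invariant set (`jointTilings`), which is the graph of a conjugacy. Minimality of `X_φ`
(`fibSystem_subset`) makes its projection to `X_φ` onto, and `tiles_unique` makes both projections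
injective. Constant `y`, for which uniqueness fails, are excluded by condition 2.

Necessity: a conjugacy from `X_φ` to `Y` is a sliding block code of some radius `L`
(`exists_radius`). The words `φ ^ k (0)` and `φ ^ k (1)`, concatenated in either order, agree up to
the last two letters (`exists_common_prefix`), and this common prefix is read at every cut of a
sequence of `X_φ` into words of level `k`. For large `k` the code therefore writes one long word `P`
at all cuts, moved by `L`; prefixes of `P` serve as `B_0` and `B_1`. Condition 2 holds because no
other cutting is possible.

Both directions rest on `cuts_unique`: a stray cut would give `P` a short third period besides its
two coprime Fibonacci periods, and then `P` is constant (`eq_of_three_periods`). -/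

/-! ### Periods of words and uniqueness of cuts -/

theorem periodic_of_periodic_on_range {A : Type*} {Q : ℤ → A} {g d : ℤ} (hg : 0 < g)
    (hQ : Function.Periodic Q g) (h : ∀ i, 0 ≤ i → i < g → Q (i + d) = Q i) :
    Function.Periodic Q d := by
  intro i
  have e1 : Q i = Q (i % g) := by
    conv_lhs => rw [← Int.emod_add_mul_ediv i g, mul_comm]
    exact (hQ.int_mul (i / g)) (i % g)
  have e2 : Q (i + d) = Q (i % g + d) := by
    conv_lhs => rw [← Int.emod_add_mul_ediv i g, mul_comm, add_right_comm]
    exact (hQ.int_mul (i / g)) (i % g + d)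
  rw [e1, e2]
  exact h _ (Int.emod_nonneg _ hg.ne') (Int.emod_lt_of_pos _ hg)

theorem periodic_gcd {A : Type*} {Q : ℤ → A} {a d : ℤ}
    (ha : Function.Periodic Q a) (hd : Function.Periodic Q d) :
    Function.Periodic Q (Int.gcd a d : ℤ) := by
  rw [Int.gcd_eq_gcd_ab, mul_comm a, mul_comm d]
  exact (ha.int_mul _).add_period (hd.int_mul _)

/-- A word of length `l` with coprime periods `a` and `b` and an additional short period near its
beginning is constant. -/
theorem eq_of_three_periods {A : Type*} {P : ℤ → A} {a b d l : ℤ}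
    (hab : Int.gcd a b = 1) (hd : 0 < d) (hda : d < a) (hl : 2 * a ≤ l) (hl' : a ≤ 2 * (l - b))
    (hPa : ∀ i, 0 ≤ i → i + a < l → P (i + a) = P i)
    (hPb : ∀ i, 0 ≤ i → i + b < l → P (i + b) = P i) (hb : 0 < b)
    (hPd : ∀ i, 0 ≤ i → i < a → P (i + d) = P i) :
    ∀ i, 0 ≤ i → i < l → P i = P 0 := by
  have ha : 0 < a := hd.trans hda
  -- `Q` repeats the first `a` letters of `P` on all of `ℤ`. It agrees with `P` on `[0, l)`, and its
  -- periods can be combined by gcd.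
  obtain ⟨Q, hQ⟩ : ∃ Q : ℤ → A, ∀ i, Q i = P (i % a) := ⟨fun i => P (i % a), fun _ => rfl⟩
  have key : ∀ n : ℕ, ∀ i : ℤ, i ≤ n → 0 ≤ i → i < l → P i = Q i := by
    intro n
    induction n with
    | zero =>
      intro i h1 h2 _
      obtain rfl : i = 0 := by simpa using le_antisymm h1 h2
      simp [hQ]
    | succ n ih =>
      intro i h1 h2 h3
      by_cases h : i < a
      · rw [hQ, Int.emod_eq_of_lt h2 h]
      · have := hPa (i - a) (by omega) (by omega)
        rw [sub_add_cancel] at this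
        rw [this, ih (i - a) (by push_cast at h1; omega) (by omega) (by omega), hQ, hQ,
          Int.sub_emod_right]
  have hPQ : ∀ i : ℤ, 0 ≤ i → i < l → P i = Q i := fun i h => key i.toNat i (by omega) h
  have hQa : Function.Periodic Q a := fun i => by rw [hQ, hQ, Int.add_emod_right]
  have hQd : Function.Periodic Q d := periodic_of_periodic_on_range ha hQa fun i h1 h2 => by
    rw [← hPQ _ (by omega) (by omega), ← hPQ _ (by omega) (by omega), hPd i h1 h2]
  have hQg := periodic_gcd hQa hQd
  set g : ℤ := (Int.gcd a d : ℤ) with hg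
  have hg0 : 0 < g := by rw [hg]; exact_mod_cast Int.gcd_pos_of_ne_zero_left _ ha.ne'
  have hga : g ∣ a := Int.gcd_dvd_left ..
  have hgd : g ≤ d := Int.le_of_dvd hd (Int.gcd_dvd_right ..)
  -- `g` is a proper divisor of `a`, so a full window of length `g` fits into the range of length `l
  -- - b ≥ a / 2` where the period `b` is known.
  have hg2 : 2 * g ≤ a := by
    obtain ⟨c, hc⟩ := hga
    have : 2 ≤ c := by
      by_contra hcon
      have : c ≤ 1 := by omega
      nlinarith
    nlinarith
  have hQb : Function.Periodic Q b := periodic_of_periodic_on_range hg0 hQg fun i h1 h2 => by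
    rw [← hPQ _ (by omega) (by omega), ← hPQ _ (by omega) (by omega), hPb i h1 (by omega)]
  have hQ1 := periodic_gcd hQa hQb
  rw [hab] at hQ1
  intro i h1 h2
  rw [hPQ i h1 h2, hPQ 0 le_rfl (by omega)]
  simpa using (hQ1.int_mul i) 0

theorem exists_between_cuts {s : ℤ → ℤ} (h : ∀ k, s k < s (k + 1)) (t : ℤ) :
    ∃ k, s k ≤ t ∧ t < s (k + 1) := by
  have up : ∀ n : ℕ, s 0 + n ≤ s n := by
    intro n
    induction n with
    | zero => simp
    | succ n ih => have := h n; push_cast; omega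
  have down : ∀ n : ℕ, s (-n) ≤ s 0 - n := by
    intro n
    induction n with
    | zero => simp
    | succ n ih =>
      have := h (-(n : ℤ) - 1)
      rw [sub_add_cancel] at this
      have e : (-((n + 1 : ℕ) : ℤ)) = -(n : ℤ) - 1 := by push_cast; ring
      rw [e]; push_cast; omega
  have hm := strictMono_int_of_lt_succ h
  obtain ⟨k, hk, hk'⟩ := Int.exists_greatest_of_bdd (P := fun k => s k ≤ t)
    ⟨(t - s 0).toNat + 1, fun z hz => by
      by_contra hlt
      have h1 := hm (not_le.1 hlt)
      have h2 := up ((t - s 0).toNat + 1)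
      push_cast at h2
      omega⟩
    ⟨-((s 0 - t).toNat : ℤ), by have := down (s 0 - t).toNat; omega⟩
  refine ⟨k, hk, ?_⟩
  by_contra hlt
  have := hk' (k + 1) (not_lt.1 hlt)
  omega

/-- Uniqueness of the cuts: `y` is cut by `s` into pieces of lengths `a` and `b`, and a common
word `P` of length `l` occurs at all these cuts. Any other way `s'` of cutting `y` into the
prefixes of `P` of lengths `a` and `b` is a re-indexing of `s`, unless `P` is constant. -/
theorem cuts_unique {A : Type*} {y P : ℤ → A} {a b l : ℤ} {s s' : ℤ → ℤ}
    (hab : Int.gcd a b = 1) (hlt : a < b) (hlt' : b < 2 * a) (hl : 2 * a ≤ l)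
    (hl' : a ≤ 2 * (l - b))
    (hs : ∀ k, s (k + 1) = s k + a ∨ s (k + 1) = s k + b)
    (hsa : ∃ k, s (k + 1) = s k + a) (hsb : ∃ k, s (k + 1) = s k + b)
    (hP : ∀ k i, 0 ≤ i → i < l → y (s k + i) = P i)
    (hs' : ∀ k, s' (k + 1) = s' k + a ∨ s' (k + 1) = s' k + b)
    (hP' : ∀ k i, 0 ≤ i → s' k + i < s' (k + 1) → y (s' k + i) = P i)
    (hne : ∃ i, 0 ≤ i ∧ i < l ∧ P i ≠ P 0) :
    ∃ j, ∀ k, s' k = s (k + j) := by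
  have hPa : ∀ i, 0 ≤ i → i + a < l → P (i + a) = P i := by
    obtain ⟨k, hk⟩ := hsa
    intro i h1 h2
    rw [← hP k (i + a) (by omega) h2, ← hP (k + 1) i h1 (by omega), hk]
    congr 1; ring
  have hPb : ∀ i, 0 ≤ i → i + b < l → P (i + b) = P i := by
    obtain ⟨k, hk⟩ := hsb
    intro i h1 h2
    rw [← hP k (i + b) (by omega) h2, ← hP (k + 1) i h1 (by omega), hk]
    congr 1; ring
  have key : ∀ d, 0 < d → d < a → ¬ ∀ i, 0 ≤ i → i < a → P (i + d) = P i := by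
    intro d h1 h2 h3
    obtain ⟨i, hi, hi', hi''⟩ := hne
    exact hi'' (eq_of_three_periods hab h1 h2 hl hl' hPa hPb (by omega) h3 i hi hi')
  -- A cut of `s'` less than `a` after a cut of `s` makes `P` overlap itself, against `key`.
  have near : ∀ k k', s k < s' k' → s' k' < s k + a → False := by
    intro k k' h1 h2
    refine key (s' k' - s k) (by omega) (by omega) fun i h3 h4 => ?_
    rw [← hP k _ (by omega) (by omega), ← hP' k' i h3 (by rcases hs' k' with h | h <;> omega)]
    congr 1; ring
  have hmono : ∀ k, s k < s (k + 1) := fun k => by rcases hs k with h | h <;> omega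
  have cut : ∀ k', ∃ k, s k = s' k' := by
    intro k'
    obtain ⟨k, hk, hk'⟩ := exists_between_cuts hmono (s' k')
    refine ⟨k, le_antisymm hk ?_⟩
    by_contra hcon
    have h1 : s k + a ≤ s' k' := by
      by_contra h
      exact near k k' (by omega) (by omega)
    have h2 : s (k + 1) = s k + b := by rcases hs k with h | h <;> omega
    -- The stray cut lies in the last `b - a` letters of a long piece. After a short step the next
    -- cut falls less than `a` behind `s (k + 1)`; a long block instead overlaps the copy of `P` at
    -- `s (k + 1)`.
    rcases hs' k' with h | h
    · exact near (k + 1) (k' + 1) (by omega) (by omega)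
    · refine key (s (k + 1) - s' k') (by omega) (by omega) fun i h3 h4 => ?_
      rw [← hP' k' _ (by omega) (by omega), ← hP (k + 1) i h3 (by omega)]
      congr 1; ring
  have step : ∀ k k', s k = s' k' → s (k + 1) = s' (k' + 1) := by
    intro k k' h
    obtain ⟨j, hj⟩ := cut (k' + 1)
    have hm := strictMono_int_of_lt_succ hmono
    have h1 : k < j := hm.lt_iff_lt.1 (by rcases hs' k' with h | h <;> omega)
    have h2 : j < k + 1 + 1 := hm.lt_iff_lt.1 (by
      rcases hs' k' with h | h <;> rcases hs k with h' | h' <;>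
        rcases hs (k + 1) with h'' | h'' <;> omega)
    rw [← hj]
    congr 1; omega
  have step' : ∀ k k', s k = s' k' → s (k - 1) = s' (k' - 1) := by
    intro k k' h
    obtain ⟨j, hj⟩ := cut (k' - 1)
    have := step _ _ hj
    rw [sub_add_cancel, ← h] at this
    have hm := strictMono_int_of_lt_succ hmono
    have := hm.injective this
    rw [← hj]
    congr 1; omega
  obtain ⟨j, hj⟩ := cut 0
  refine ⟨j, fun k => ?_⟩
  induction k using Int.induction_on with
  | zero => rw [zero_add, hj]
  | succ k ih => rw [← step _ _ ih.symm]; congr 1; ring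
  | pred k ih => rw [← step' _ _ ih.symm]; congr 1; ring

/-! ### Words read in a sequence, and tilings by two blocks -/

/-- The word `w` occurs in `y` at position `t`. -/
def Reads {A : Type*} (y : ℤ → A) (t : ℤ) (w : List A) : Prop :=
  ∀ (i : ℕ) (hi : i < w.length), y (t + (i : ℤ)) = w[i]

/-- `y` is the concatenation of the blocks `B (x k)`, the `k`-th one starting at `s k`. -/
def Tiles {A : Type*} (B : Fin 2 → List A) (x : ℤ → Fin 2) (s : ℤ → ℤ) (y : ℤ → A) : Prop :=
  ∀ k : ℤ, s (k + 1) = s k + ((B (x k)).length : ℤ) ∧ Reads y (s k) (B (x k))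

theorem fin_two_cases (a : Fin 2) : a = 0 ∨ a = 1 := by omega

section Words

variable {A : Type*} {y z : ℤ → A} {t : ℤ} {u v w : List A}

theorem isConcatenation_iff {B : Fin 2 → List A} {x : ℤ → Fin 2} :
    IsConcatenation B x y ↔ ∃ s, Tiles B x s y := Iff.rfl

theorem reads_append : Reads y t (u ++ v) ↔ Reads y t u ∧ Reads y (t + u.length) v := by
  constructor
  · intro h
    refine ⟨fun i hi => ?_, fun i hi => ?_⟩
    · rw [h i (by simp; omega), List.getElem_append_left]
    · have := h (u.length + i) (by simp; omega)
      rw [List.getElem_append_right (by omega)] at this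
      simp only [Nat.add_sub_cancel_left] at this
      rw [← this]; congr 1; push_cast; ring
  · rintro ⟨h1, h2⟩ i hi
    by_cases hlt : i < u.length
    · rw [h1 i hlt, List.getElem_append_left]
    · rw [List.getElem_append_right (by omega), ← h2 (i - u.length) (by simp at hi; omega)]
      congr 1; push_cast [not_lt.1 hlt]; ring

theorem Reads.of_prefix (h : Reads y t v) (huv : u <+: v) : Reads y t u := by
  obtain ⟨w, rfl⟩ := huv
  exact (reads_append.1 h).1

theorem Reads.of_infix (h : Reads y t v) (huv : u <:+: v) : ∃ t', Reads y t' u := by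
  obtain ⟨w, w', rfl⟩ := huv
  exact ⟨_, (reads_append.1 (reads_append.1 h).1).2⟩

theorem Reads.append (h : Reads y t u) {t' : ℤ} (ht : t' = t + u.length) (h' : Reads y t' v) :
    Reads y t (u ++ v) := reads_append.2 ⟨h, ht ▸ h'⟩

theorem reads_shift {g : ℤ} : Reads (shift g y) t w ↔ Reads y (t + g) w := by
  refine forall₂_congr fun i hi => ?_
  rw [shift_apply]
  congr! 2; ring

theorem reads_ofFn {n : ℕ} : Reads y t (List.ofFn fun i : Fin n => y (t + (i : ℕ))) := by
  intro i hi
  simp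

theorem reads_ofFn_iff {n : ℕ} {f : ℕ → A} :
    Reads y t (List.ofFn fun i : Fin n => f i) ↔ ∀ i < n, y (t + (i : ℤ)) = f i := by
  constructor
  · intro h i hi
    rw [h i (by simpa using hi), List.getElem_ofFn]
  · intro h i hi
    simpa using h i (by simpa using hi)

theorem Reads.infix_of_le (hu : Reads y t u) {t' : ℤ} (hv : Reads y t' v) (h : t ≤ t')
    (h' : t' + v.length ≤ t + u.length) : v <:+: u := by
  rw [List.infix_iff_getElem?]
  refine ⟨(t' - t).toNat, by omega, fun i hi => ?_⟩
  rw [List.getElem?_eq_getElem (by omega), ← hu _ (by omega), ← hv i hi]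
  congr 2; push_cast; omega

theorem Reads.congr (hu : Reads y t w) {t' : ℤ}
    (h : ∀ i : ℕ, i < w.length → z (t' + i) = y (t + i)) : Reads z t' w := fun i hi => by rw [h i hi, hu i hi]

end Words

section Tilings

variable {A : Type*} {B : Fin 2 → List A} {x : ℤ → Fin 2} {s : ℤ → ℤ} {y : ℤ → A}

theorem Tiles.step_lt (hB : ∀ a, B a ≠ []) (h : Tiles B x s y) (k : ℤ) : s k < s (k + 1) := by
  have := List.length_pos_of_ne_nil (hB (x k))
  rw [(h k).1]; omega

theorem Tiles.reindex (h : Tiles B x s y) (j : ℤ) :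
    Tiles B (shift j x) (fun k => s (j + k)) y := by
  intro k
  have := h (j + k)
  rw [add_assoc] at this
  simpa [shift_apply] using this

theorem Tiles.shift (h : Tiles B x s y) (g : ℤ) :
    Tiles B x (fun k => s k - g) (shift g y) := by
  intro k
  refine ⟨?_, ?_⟩
  · have := (h k).1
    simp only [this]; ring
  · rw [reads_shift, sub_add_cancel]
    exact (h k).2

theorem Tiles.reads_flatMap (h : Tiles B x s y) {w : List (Fin 2)} {r : ℤ} (hw : Reads x r w) :
    Reads y (s r) (w.flatMap B) ∧ s (r + w.length) = s r + (w.flatMap B).length := by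
  induction w generalizing r with
  | nil => simp [Reads]
  | cons a w ih =>
    have hw' := (reads_append (u := [a]) (v := w)).1 hw
    have ha : x r = a := by simpa using hw'.1 0 (by simp)
    have hk := h r
    rw [ha] at hk
    obtain ⟨i1, i2⟩ := ih (r := r + 1) (by simpa using hw'.2)
    rw [hk.1] at i1 i2
    rw [List.flatMap_cons]
    refine ⟨reads_append.2 ⟨hk.2, i1⟩, ?_⟩
    rw [List.length_append, List.length_cons]
    push_cast
    rw [add_comm (w.length : ℤ), ← add_assoc, i2, add_assoc]

theorem Tiles.comp {C : Fin 2 → List (Fin 2)} {x' : ℤ → Fin 2} {r : ℤ → ℤ}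
    (h' : Tiles C x' r x) (h : Tiles B x s y) :
    Tiles (fun a => (C a).flatMap B) x' (fun k => s (r k)) y := by
  intro k
  obtain ⟨h1, h2⟩ := h.reads_flatMap (h' k).2
  exact ⟨by simp only [(h' k).1, h2], h1⟩

theorem exists_cuts (f : ℤ → ℕ) : ∃ s : ℤ → ℤ, ∀ k, s (k + 1) = s k + f k := by
  refine ⟨fun k => ∑ i ∈ Finset.Ico 0 k, (f i : ℤ) - ∑ i ∈ Finset.Ico k 0, (f i : ℤ), fun k => ?_⟩
  beta_reduce
  rcases le_or_gt 0 k with hk | hk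
  · have e : Finset.Ico 0 (k + 1) = insert k (Finset.Ico 0 k) := by ext; simp; omega
    rw [e, Finset.sum_insert (by simp), Finset.Ico_eq_empty (a := k + 1) (by omega),
      Finset.Ico_eq_empty (a := k) (by omega)]
    simp [add_comm]
  · have e : Finset.Ico k 0 = insert k (Finset.Ico (k + 1) 0) := by ext; simp; omega
    rw [e, Finset.sum_insert (by simp), Finset.Ico_eq_empty (b := k + 1) (by omega),
      Finset.Ico_eq_empty (b := k) (by omega)]
    simp

theorem exists_tiles_of_cuts (hB : ∀ a, B a ≠ [])
    (hs : ∀ k, s (k + 1) = s k + (B (x k)).length) : ∃ z, Tiles B x s z := by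
  have hlt : ∀ k, s k < s (k + 1) := fun k => by
    have := List.length_pos_of_ne_nil (hB (x k))
    rw [hs k]; omega
  choose K hK hK' using exists_between_cuts hlt
  refine ⟨fun t => (B (x (K t)))[(t - s (K t)).toNat]'(by
    have := hs (K t); have := hK t; have := hK' t; omega), fun k => ⟨hs k, fun i hi => ?_⟩⟩
  have hm := strictMono_int_of_lt_succ hlt
  have e : K (s k + i) = k := by
    have h1 : K (s k + i) < k + 1 := hm.lt_iff_lt.1 (by
      have := hK (s k + i); have := hs k; omega)
    have h2 : k < K (s k + i) + 1 := hm.lt_iff_lt.1 (by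
      have := hK' (s k + i); omega)
    omega
  simp [e]

theorem exists_tiles (hB : ∀ a, B a ≠ []) (x : ℤ → Fin 2) : ∃ s z, Tiles B x s z := by
  obtain ⟨s, hs⟩ := exists_cuts fun k => (B (x k)).length
  obtain ⟨z, hz⟩ := exists_tiles_of_cuts hB hs
  exact ⟨s, z, hz⟩

theorem Tiles.ext (hB : ∀ a, B a ≠ []) {z : ℤ → A} (h : Tiles B x s y) (h' : Tiles B x s z) :
    y = z := by
  funext t
  obtain ⟨k, hk, hk'⟩ := exists_between_cuts (h.step_lt hB) t
  have h1 := (h k).2 (t - s k).toNat (by have := (h k).1; omega)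
  have h2 := (h' k).2 (t - s k).toNat (by have := (h k).1; omega)
  have e : s k + ((t - s k).toNat : ℤ) = t := by omega
  rw [e] at h1 h2
  rw [h1, h2]

theorem Tiles.eq_of_cuts_eq (hB : (B 1).length ≠ (B 0).length) (h : Tiles B x s y)
    {x' : ℤ → Fin 2} {z : ℤ → A} (h' : Tiles B x' s z) : x = x' := by
  funext k
  have h1 := (h k).1
  have h2 := (h' k).1
  rcases fin_two_cases (x k) with e | e <;> rcases fin_two_cases (x' k) with e' | e' <;>
    rw [e] at h1 ⊢ <;> rw [e'] at h2 ⊢ <;> omega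

end Tilings

/-! ### The hierarchy of Fibonacci words over arbitrary blocks -/

section Levels

/-- The words `φ ^ k (a)` with `0` and `1` replaced by `B 0` and `B 1`. -/
def level {A : Type*} (B : Fin 2 → List A) (k : ℕ) (a : Fin 2) : List A :=
  (fibSubst^[k] [a]).flatMap B

variable {A : Type*} {B : Fin 2 → List A} {p : ℕ}

theorem fibSubst_iterate_succ_zero (k : ℕ) :
    fibSubst^[k + 1] [0] = fibSubst^[k] [0] ++ fibSubst^[k] [1] := by
  rw [← fibSubst_iterate_append, Function.iterate_succ_apply]; rfl

theorem fibSubst_iterate_succ_one (k : ℕ) : fibSubst^[k + 1] [1] = fibSubst^[k] [0] := by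
  rw [Function.iterate_succ_apply]; rfl

theorem level_succ_zero (k : ℕ) : level B (k + 1) 0 = level B k 0 ++ level B k 1 := by
  simp [level, fibSubst_iterate_succ_zero]

theorem level_succ_one (k : ℕ) : level B (k + 1) 1 = level B k 0 := by
  simp [level, fibSubst_iterate_succ_one]

theorem level_zero (a : Fin 2) : level B 0 a = B a := by simp [level]

theorem level_singleton (k : ℕ) (a : Fin 2) : level (fun b => [b]) k a = fibSubst^[k] [a] := by
  simp [level]

theorem length_level (h0 : (B 0).length = Nat.fib (p + 1)) (h1 : (B 1).length = Nat.fib p)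
    (k : ℕ) : (level B k 0).length = Nat.fib (p + k + 1) ∧ (level B k 1).length = Nat.fib (p + k) := by
  induction k with
  | zero => simp [level_zero, h0, h1]
  | succ k ih =>
    rw [level_succ_zero, level_succ_one, List.length_append, ih.1, ih.2]
    exact ⟨(Nat.add_comm _ _).trans Nat.fib_add_two.symm, rfl⟩

/-- The two concatenations of the words of level `k` agree up to a suffix of bounded length. -/
theorem exists_common_prefix (B : Fin 2 → List A) (k : ℕ) :
    ∃ z : List A, z.length + ((B 0).length + (B 1).length) =
        (level B k 0).length + (level B k 1).length ∧
      z <+: level B k 0 ++ level B k 1 ∧ z <+: level B k 1 ++ level B k 0 := by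
  induction k with
  | zero => exact ⟨[], by simp [level_zero], List.nil_prefix, List.nil_prefix⟩
  | succ k ih =>
    obtain ⟨z, hz, h0, h1⟩ := ih
    refine ⟨level B k 0 ++ z, ?_, ?_, ?_⟩
    · rw [level_succ_zero, level_succ_one]
      simp only [List.length_append]
      omega
    · rw [level_succ_zero, level_succ_one, List.append_assoc]
      exact (List.prefix_append_right_inj _).2 h1
    · rw [level_succ_zero, level_succ_one]
      exact (List.prefix_append_right_inj _).2 h0

/-- As `11` is absent, the tiles from `s j` on begin with `01`, `10` or `00`. The case `00` reduces
to `01` because `level B (k + 1) 1` is a prefix of `level B (k + 1) 0`, which needs a level of at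
least one. -/
theorem Tiles.reads_common_prefix {k : ℕ} {x : ℤ → Fin 2} {s : ℤ → ℤ} {y : ℤ → A}
    (h : Tiles (level B (k + 1)) x s y) (hx : ∀ i, x i = 0 ∨ x (i + 1) = 0) {z : List A}
    (h0 : z <+: level B (k + 1) 0 ++ level B (k + 1) 1)
    (h1 : z <+: level B (k + 1) 1 ++ level B (k + 1) 0) (j : ℤ) : Reads y (s j) z := by
  have hj := h j
  have hj' := h (j + 1)
  rcases fin_two_cases (x j) with e | e
  · rw [e] at hj
    refine (hj.2.append hj.1 (hj'.2.of_prefix ?_)).of_prefix h0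
    rcases fin_two_cases (x (j + 1)) with e' | e'
    · rw [e', level_succ_zero, level_succ_one]
      exact List.prefix_append ..
    · rw [e']
  · rw [(hx j).resolve_left (by simp [e])] at hj'
    rw [e] at hj
    exact (hj.2.append hj.1 hj'.2).of_prefix h1

end Levels

/-! ### The Fibonacci language and its uniform recurrence -/

section Language

theorem infix_append_cases {α : Type*} {w u v : List α} (h : w <:+: u ++ v) :
    w <:+: u ∨ w <:+: v ∨ ∃ a b, w = a ++ b ∧ a <:+ u ∧ b <+: v := by
  obtain ⟨s, t, h⟩ := h
  rw [List.append_assoc] at h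
  rcases List.append_eq_append_iff.1 h with ⟨c, rfl, hc⟩ | ⟨c, rfl, hc⟩
  · rcases List.append_eq_append_iff.1 hc with ⟨d, rfl, rfl⟩ | ⟨d, rfl, rfl⟩
    · exact Or.inl ⟨s, d, by simp⟩
    · exact Or.inr (Or.inr ⟨c, d, rfl, List.suffix_append .., List.prefix_append ..⟩)
  · exact Or.inr (Or.inl ⟨c, t, by simp [hc]⟩)

/-- The words `φ ^ m (0)`. -/
def fibWord (m : ℕ) : List (Fin 2) := fibSubst^[m] [0]

theorem fibWord_add_two (m : ℕ) : fibWord (m + 2) = fibWord (m + 1) ++ fibWord m := by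
  rw [fibWord, fibSubst_iterate_succ_zero, fibSubst_iterate_succ_one]; rfl

theorem length_fibWord (m : ℕ) : (fibWord m).length = Nat.fib (m + 2) :=
  (length_fibSubst_iterate m).1

theorem fibWord_prefix_succ (m : ℕ) : fibWord m <+: fibWord (m + 1) := by
  rw [fibWord, fibWord, fibSubst_iterate_succ_zero]; exact List.prefix_append ..

theorem fibWord_prefix {m n : ℕ} (h : m ≤ n) : fibWord m <+: fibWord n := by
  induction n, h using Nat.le_induction with
  | base => exact List.prefix_refl _
  | succ n _ ih => exact ih.trans (fibWord_prefix_succ n)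

theorem fibWord_suffix (m j : ℕ) : fibWord m <:+ fibWord (m + 2 * j) := by
  induction j with
  | zero => exact List.suffix_refl _
  | succ j ih =>
    refine ih.trans ?_
    rw [show m + 2 * (j + 1) = m + 2 * j + 2 by ring, fibWord_add_two]
    exact List.suffix_append ..

theorem fibWord_eq_cons (m : ℕ) : ∃ w, fibWord m = 0 :: w := by
  obtain ⟨w, hw⟩ := fibWord_prefix (Nat.zero_le m)
  exact ⟨w, hw.symm⟩

theorem not_one_one_infix_fibWord (m : ℕ) : ¬ [1, 1] <:+: fibWord m := by
  induction m using Nat.twoStepInduction with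
  | zero => intro h; have := h.length_le; simp [fibWord] at this
  | one =>
    intro h
    have := List.IsInfix.eq_of_length h rfl
    revert this; decide
  | more m ih0 ih1 =>
    rw [fibWord_add_two]
    intro h
    rcases infix_append_cases h with h | h | ⟨a, b, hab, ha, hb⟩
    · exact ih1 h
    · exact ih0 h
    · obtain ⟨w, hw⟩ := fibWord_eq_cons m
      obtain ⟨c, hc⟩ := hb
      rcases b with _ | ⟨i, b⟩
      · rw [List.append_nil] at hab
        exact ih1 (hab ▸ ha.isInfix)
      · rw [hw, List.cons_append] at hc
        obtain rfl : i = 0 := (List.cons.inj hc).1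
        have : (0 : Fin 2) ∈ [1, 1] := by rw [hab]; simp
        revert this; decide

/-- Long words of the Fibonacci language contain `φ ^ m (0)`. -/
theorem fibWord_infix_of_length_le {m M : ℕ} {w : List (Fin 2)} (h : w <:+: fibWord M)
    (hw : Nat.fib (m + 4) ≤ w.length) : fibWord m <:+: w := by
  induction M using Nat.twoStepInduction with
  | zero =>
    have := h.length_le
    have h3 : Nat.fib 4 ≤ Nat.fib (m + 4) := Nat.fib_mono (by omega)
    rw [length_fibWord] at this
    simp [Nat.fib_add_two] at this h3 hw
    omega
  | one =>
    have := h.length_le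
    have h3 : Nat.fib 4 ≤ Nat.fib (m + 4) := Nat.fib_mono (by omega)
    rw [length_fibWord] at this
    simp [Nat.fib_add_two] at this h3 hw
    omega
  | more M ih0 ih1 =>
    rw [fibWord_add_two] at h
    rcases infix_append_cases h with h | h | ⟨a, b, rfl, ha, hb⟩
    · exact ih1 h
    · exact ih0 h
    · have hlen : Nat.fib (m + 3) ≤ a.length ∨ Nat.fib (m + 2) ≤ b.length := by
        rw [List.length_append, Nat.fib_add_two (n := m + 2)] at hw
        have : Nat.fib (m + 2 + 1) = Nat.fib (m + 3) := rfl
        omega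
      -- Fibonacci words whose indices have the same parity are suffixes of one another. For the
      -- wrong parity `fibWord (m + 1)`, which begins with `fibWord m`, is used; hence the larger
      -- bound on `a`.
      have key : ∀ j, (fibWord j).length ≤ a.length → j % 2 = (M + 1) % 2 → fibWord j <:+ a := by
        intro j hj hj'
        have h1 : fibWord j <:+ fibWord (j + 2 * ((M + 1 + j) / 2)) := fibWord_suffix ..
        have h2 : fibWord (M + 1) <:+ fibWord (M + 1 + 2 * j) := fibWord_suffix ..
        have h3 : M + 1 + 2 * j = j + 2 * ((M + 1 + j) / 2) := by omega
        rw [h3] at h2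
        exact List.suffix_of_suffix_length_le h1 (ha.trans h2) hj
      rcases hlen with hlen | hlen
      · refine List.infix_append_of_infix_left ?_
        by_cases hpar : m % 2 = (M + 1) % 2
        · refine (key m ?_ hpar).isInfix
          rw [length_fibWord]
          exact (Nat.fib_mono (by omega)).trans hlen
        · refine (fibWord_prefix_succ m).isInfix.trans (key (m + 1) ?_ (by omega)).isInfix
          rw [length_fibWord]
          exact hlen
      · refine List.infix_append_of_infix_right (List.IsPrefix.isInfix ?_)
        exact List.prefix_of_prefix_length_le (fibWord_prefix (le_max_left m M))
          (hb.trans (fibWord_prefix (le_max_right m M))) (by rwa [length_fibWord])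

/-- The factors of the words `φ ^ m (0)`. -/
def InLang (w : List (Fin 2)) : Prop := ∃ m, w <:+: fibWord m

theorem flatMap_iterate (m : ℕ) (u : List (Fin 2)) :
    u.flatMap (fun a => fibSubst^[m] [a]) = fibSubst^[m] u := by
  induction u with
  | nil =>
    induction m with
    | zero => rfl
    | succ m ih => rw [Function.iterate_succ_apply]; exact ih
  | cons a u ih =>
    rw [List.flatMap_cons, ih, ← fibSubst_iterate_append]; rfl

theorem InLang.iterate {u : List (Fin 2)} (h : InLang u) (m : ℕ) : InLang (fibSubst^[m] u) := by
  obtain ⟨j, s, t, h⟩ := h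
  refine ⟨m + j, fibSubst^[m] s, fibSubst^[m] t, ?_⟩
  rw [← fibSubst_iterate_append, ← fibSubst_iterate_append, h, fibWord, fibWord,
    Function.iterate_add_apply]

theorem InLang.of_infix {u v : List (Fin 2)} (h : InLang v) (huv : u <:+: v) : InLang u := by
  obtain ⟨j, h⟩ := h
  exact ⟨j, huv.trans h⟩

end Language

/-! ### Membership in the Fibonacci system, and minimality -/

section System

/-- Cylinders form a basis of the product topology, so approximation by the orbit is a matter of
finite words. -/
theorem mem_closure_orbit_iff {A : Type*} [TopologicalSpace A] [DiscreteTopology A]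
    {x p : ℤ → A} :
    x ∈ closure (Set.range fun g : ℤ => shift g p) ↔
      ∀ t w, Reads x t w → ∃ t', Reads p t' w := by
  constructor
  · intro h t w hw
    let U : Set (ℤ → A) := Set.pi (Finset.Ico t (t + w.length) : Set ℤ) fun i => {x i}
    have hU : IsOpen U := isOpen_set_pi (Finset.finite_toSet _) fun _ _ => isOpen_discrete _
    obtain ⟨_, hz, g, rfl⟩ := mem_closure_iff.1 h U hU fun i _ => rfl
    refine ⟨t + g, reads_shift.1 (hw.congr fun i hi => ?_)⟩
    exact hz (t + i) (by simpa using hi)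
  · intro h
    rw [mem_closure_iff]
    intro U hU hx
    obtain ⟨I, u, hu, hIU⟩ := isOpen_pi_iff.1 hU x hx
    obtain ⟨N, hN⟩ : ∃ N : ℕ, ∀ i ∈ I, i.natAbs < N :=
      ⟨I.sup Int.natAbs + 1, fun i hi => Nat.lt_succ_of_le (Finset.le_sup (f := Int.natAbs) hi)⟩
    obtain ⟨t', ht'⟩ := h (-N) _ (reads_ofFn (y := x) (t := -N) (n := 2 * N))
    refine ⟨shift (t' + N) p, hIU fun i hi => ?_, _, rfl⟩
    have h1 := hN i hi
    have h2 := (reads_ofFn_iff (f := fun j : ℕ => x (-N + (j : ℤ)))).1 ht' (i + N).toNat (by omega)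
    have e1 : t' + ((i + N).toNat : ℤ) = t' + N + i := by omega
    have e2 : -(N : ℤ) + ((i + N).toNat : ℤ) = i := by omega
    simp only [e1, e2] at h2
    rw [shift_apply, h2]
    exact (hu i hi).2

theorem reads_fibPoint_right (m : ℕ) : Reads fibPoint 0 (fibWord m) := by
  intro i hi
  rw [zero_add]
  have h1 := fibWord_prefix (le_max_left i m)
  have h2 := fibWord_prefix (le_max_right i m)
  exact (h1.getElem (lt_length_zero i)).trans (h2.getElem hi).symm

theorem reads_fibPoint_left (m : ℕ) :
    Reads fibPoint (-((fibSubst^[2 * m] [1]).length : ℤ)) (fibSubst^[2 * m] [1]) := by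
  have mono : ∀ i j, i ≤ j → fibSubst^[2 * i] [1] <:+ fibSubst^[2 * j] [1] := by
    intro i j h
    induction j, h using Nat.le_induction with
    | base => exact List.suffix_refl _
    | succ j _ ih =>
      refine ih.trans ?_
      rw [show 2 * (j + 1) = 2 * j + 1 + 1 by ring, fibSubst_iterate_succ_one,
        fibSubst_iterate_succ_zero]
      exact List.suffix_append ..
  intro i hi
  set L := fibSubst^[2 * m] [1] with hL
  obtain ⟨q, hq⟩ : ∃ q, i + q + 1 = L.length := ⟨L.length - i - 1, by omega⟩
  have e : -(L.length : ℤ) + i = Int.negSucc q := by rw [Int.negSucc_eq]; omega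
  rw [e]
  have h1 := List.reverse_prefix.2 (mono _ _ (le_max_left q m))
  have h2 := List.reverse_prefix.2 (mono _ _ (le_max_right q m))
  change ((fibSubst^[2 * q] [1]).reverse)[q]'(lt_length_one q) = _
  have h3 : L[i] = L.reverse[q]'(by rw [List.length_reverse]; omega) := by
    rw [List.getElem_reverse]; congr 1; omega
  rw [h3, h1.getElem, h2.getElem]

theorem inLang_of_reads_fibPoint {t : ℤ} {w : List (Fin 2)} (h : Reads fibPoint t w) :
    InLang w := by
  obtain ⟨m, hm1, hm2⟩ : ∃ m : ℕ, -(m : ℤ) ≤ t ∧ t + w.length ≤ m :=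
    ⟨t.natAbs + w.length, by omega, by omega⟩
  have h1 := reads_fibPoint_left m
  have h2 := h1.append (by ring) (reads_fibPoint_right (2 * m))
  have l1 := lt_length_one m
  have l2 := lt_length_zero (2 * m)
  rw [List.length_reverse] at l1
  have h3 := h2.infix_of_le h (by omega) (by rw [List.length_append, fibWord]; omega)
  refine InLang.of_infix ?_ h3
  -- The word across the origin is `φ ^ (2 * m) (10)`, and `10` occurs in `φ ^ 2 (0) = 010`.
  have h4 : InLang [1, 0] := ⟨2, [0], [], by decide⟩
  have := h4.iterate (2 * m)
  rwa [show [1, 0] = [1] ++ [(0 : Fin 2)] from rfl, fibSubst_iterate_append] at this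

theorem mem_fibSystem_iff {x : ℤ → Fin 2} :
    x ∈ fibSystem.carrier ↔ ∀ t w, Reads x t w → InLang w := by
  refine mem_closure_orbit_iff.trans (forall₃_congr fun t w _ => ⟨?_, ?_⟩)
  · rintro ⟨t', h⟩
    exact inLang_of_reads_fibPoint h
  · rintro ⟨m, h⟩
    exact (reads_fibPoint_right m).of_infix h

variable {x : ℤ → Fin 2}

theorem exists_reads_fibWord (hx : x ∈ fibSystem.carrier) (m : ℕ) :
    ∃ t, Reads x t (fibWord m) := by
  have hr := reads_ofFn (y := x) (t := 0) (n := Nat.fib (m + 4))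
  obtain ⟨M, h⟩ := mem_fibSystem_iff.1 hx _ _ hr
  exact hr.of_infix (fibWord_infix_of_length_le h (by simp))

theorem eq_zero_or_succ_eq_zero (hx : x ∈ fibSystem.carrier) (i : ℤ) :
    x i = 0 ∨ x (i + 1) = 0 := by
  by_contra hcon
  rw [not_or] at hcon
  have h0 := (fin_two_cases (x i)).resolve_left hcon.1
  have h1 := (fin_two_cases (x (i + 1))).resolve_left hcon.2
  have : Reads x i [1, 1] := by
    intro j hj
    have : j = 0 ∨ j = 1 := by simp at hj; omega
    rcases this with rfl | rfl <;> simp [h0, h1]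
  obtain ⟨m, hm⟩ := mem_fibSystem_iff.1 hx _ _ this
  exact not_one_one_infix_fibWord m hm

theorem exists_zero_one (hx : x ∈ fibSystem.carrier) : ∃ i, x i = 0 ∧ x (i + 1) = 1 := by
  obtain ⟨t, ht⟩ := exists_reads_fibWord hx 1
  refine ⟨t, ?_, ?_⟩
  · simpa [fibWord, fibSubst, fibLetter] using ht 0 (by decide)
  · simpa [fibWord, fibSubst, fibLetter] using ht 1 (by decide)

/-- `X_φ` is minimal. -/
theorem fibSystem_subset {Z : Set (ℤ → Fin 2)} (hZ : IsClosed Z)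
    (hinv : ∀ z ∈ Z, ∀ g : ℤ, shift g z ∈ Z) (hx : x ∈ fibSystem.carrier) (hxZ : x ∈ Z) :
    fibSystem.carrier ⊆ Z := by
  have hp : fibPoint ∈ Z := by
    -- Each word of `fibPoint` lies in some `φ ^ m (0)`, and that word occurs in `x` by uniform
    -- recurrence.
    have h : fibPoint ∈ closure (Set.range fun g : ℤ => shift g x) := by
      rw [mem_closure_orbit_iff]
      intro t w hw
      obtain ⟨m, hm⟩ := inLang_of_reads_fibPoint hw
      obtain ⟨t', ht'⟩ := exists_reads_fibWord hx m
      exact ht'.of_infix hm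
    refine closure_minimal ?_ hZ h
    rintro _ ⟨g, rfl⟩
    exact hinv x hxZ g
  refine closure_minimal ?_ hZ
  rintro _ ⟨g, rfl⟩
  exact hinv _ hp g

theorem iterate_ne_nil (m : ℕ) (a : Fin 2) : fibSubst^[m] [a] ≠ [] := by
  rw [← List.length_pos_iff]
  rcases fin_two_cases a with rfl | rfl
  · rw [(length_fibSubst_iterate m).1]; exact Nat.fib_pos.2 (by omega)
  · rw [(length_fibSubst_iterate m).2]; exact Nat.fib_pos.2 (by omega)

/-- A window of `z` is covered by finitely many tiles, that is, by the image under `φ ^ m` of a word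
of `x`, and `φ` preserves the language. -/
theorem mem_fibSystem_of_tiles (hx : x ∈ fibSystem.carrier) {m : ℕ} {s : ℤ → ℤ} {z : ℤ → Fin 2}
    (h : Tiles (fun a => fibSubst^[m] [a]) x s z) : z ∈ fibSystem.carrier := by
  rw [mem_fibSystem_iff]
  intro t w hw
  have hlt := h.step_lt (iterate_ne_nil m)
  obtain ⟨k, hk, -⟩ := exists_between_cuts hlt t
  obtain ⟨k', -, hk'⟩ := exists_between_cuts hlt (t + w.length)
  have hkk : k < k' + 1 := (strictMono_int_of_lt_succ hlt).lt_iff_lt.1 (by omega)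
  have hr := reads_ofFn (y := x) (t := k) (n := (k' + 1 - k).toNat)
  have hu := mem_fibSystem_iff.1 hx _ _ hr
  obtain ⟨h1, h2⟩ := h.reads_flatMap hr
  rw [flatMap_iterate] at h1 h2
  refine (hu.iterate m).of_infix (h1.infix_of_le hw hk ?_)
  rw [← h2, List.length_ofFn, show k + ((k' + 1 - k).toNat : ℤ) = k' + 1 by omega]
  omega

end System

/-! ### Simultaneous tilings and their compactness -/

section JointTilings

variable {A A' : Type*}

/-- Pairs of sequences that are concatenated in the same way, by a sequence of the Fibonacci
system, from the blocks `B` and from the blocks `B'`. -/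
def jointTilings (B : Fin 2 → List A) (B' : Fin 2 → List A') : Set ((ℤ → A) × (ℤ → A')) :=
  {q | ∃ x ∈ fibSystem.carrier, ∃ s, Tiles B x s q.1 ∧ Tiles B' x s q.2}

theorem shift_mem_jointTilings {B : Fin 2 → List A} {B' : Fin 2 → List A'}
    {q : (ℤ → A) × (ℤ → A')} (hq : q ∈ jointTilings B B') (g : ℤ) :
    (shift g q.1, shift g q.2) ∈ jointTilings B B' := by
  obtain ⟨x, hx, s, h1, h2⟩ := hq
  exact ⟨x, hx, _, h1.shift g, h2.shift g⟩

/-- Indexing the tiles so that tile `0` covers the origin confines each cut to a finite interval.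
This supplies compactness for the cuts, which range over the non-compact `ℤ → ℤ`. -/
theorem Tiles.exists_normalized {B : Fin 2 → List A} (hB : ∀ a, B a ≠ []) {c : ℕ}
    (hc : ∀ a, (B a).length ≤ c) {x : ℤ → Fin 2} {s : ℤ → ℤ} {y : ℤ → A} (h : Tiles B x s y) :
    ∃ j : ℤ, ∀ k : ℤ, -((c : ℤ) * (|k| + 1)) ≤ s (j + k) ∧ s (j + k) ≤ c * (|k| + 1) := by
  have hlt := h.step_lt hB
  obtain ⟨j, hj, hj'⟩ := exists_between_cuts hlt 0
  have hstep : ∀ k, s (k + 1) ≤ s k + c := fun k => by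
    rw [(h k).1]; have := hc (x k); omega
  refine ⟨j, fun k => ?_⟩
  induction k using Int.induction_on with
  | zero =>
    have := hstep j
    simp only [add_zero, abs_zero, zero_add, mul_one]
    omega
  | succ k ih =>
    have h1 := hstep (j + k)
    have h2 := hlt (j + k)
    rw [abs_of_nonneg (by omega)] at ih ⊢
    rw [← add_assoc]
    constructor <;> nlinarith
  | pred k ih =>
    have h1 := hstep (j + (-k - 1))
    have h2 := hlt (j + (-k - 1))
    have e : j + (-(k : ℤ) - 1) + 1 = j + -k := by ring
    rw [e] at h1 h2
    rw [abs_of_nonpos (by omega)] at ih ⊢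
    constructor <;> nlinarith

end JointTilings

section Compactness

variable {A A' : Type*} [TopologicalSpace A] [DiscreteTopology A]
  [TopologicalSpace A'] [DiscreteTopology A']

/-- Once the letter `a` and the cut `t` are fixed, the hypothesis is a clopen condition and the
conclusion a closed one. -/
theorem isClosed_setOf_tiles (B : Fin 2 → List A) {T : Type*} [TopologicalSpace T]
    {x : T → ℤ → Fin 2} {s : T → ℤ → ℤ} {z : T → ℤ → A} (hx : Continuous x) (hs : Continuous s)
    (hz : Continuous z) : IsClosed {q | Tiles B (x q) (s q) (z q)} := by
  have e : {q | Tiles B (x q) (s q) (z q)} = ⋂ (k : ℤ) (a : Fin 2) (t : ℤ),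
      {q | (x q k = a ∧ s q k = t) →
        (s q (k + 1) = t + (B a).length ∧ Reads (z q) t (B a))} := by
    ext q
    simp only [Set.mem_iInter, Set.mem_ofPred_eq]
    constructor
    · rintro h k a t ⟨rfl, rfl⟩
      exact h k
    · exact fun h k => h k _ _ ⟨rfl, rfl⟩
  have hx' : ∀ k, Continuous fun q => x q k := fun k => (continuous_apply k).comp hx
  have hs' : ∀ k, Continuous fun q => s q k := fun k => (continuous_apply k).comp hs
  have hz' : ∀ k, Continuous fun q => z q k := fun k => (continuous_apply k).comp hz
  rw [e]
  refine isClosed_iInter fun k => isClosed_iInter fun a => isClosed_iInter fun t =>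
    isClosed_imp ?_ ?_
  · exact ((isOpen_discrete {a}).preimage (hx' k)).inter ((isOpen_discrete {t}).preimage (hs' k))
  · refine (isClosed_eq (hs' _) continuous_const).inter ?_
    have e' : {q | Reads (z q) t (B a)} =
        ⋂ (i : ℕ) (hi : i < (B a).length), {q | z q (t + i) = (B a)[i]} := by
      ext q
      simp [Reads]
    change IsClosed {q | Reads (z q) t (B a)}
    rw [e']
    exact isClosed_iInter fun i => isClosed_iInter fun hi => isClosed_eq (hz' _) continuous_const

theorem isCompact_jointTilings [Finite A] [Finite A'] {B : Fin 2 → List A} {B' : Fin 2 → List A'}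
    (hB : ∀ a, B a ≠ []) : IsCompact (jointTilings B B') := by
  let c := (B 0).length + (B 1).length
  have hc : ∀ a, (B a).length ≤ c := fun a => by
    rcases fin_two_cases a with rfl | rfl <;> simp [c]
  let S : Set (ℤ → ℤ) := Set.pi Set.univ fun k => Set.Icc (-((c : ℤ) * (|k| + 1))) (c * (|k| + 1))
  have hS : IsCompact S := isCompact_univ_pi fun k => (Set.finite_Icc _ _).isCompact
  have hX : IsCompact fibSystem.carrier := fibSystem.isClosed.isCompact
  let T : Set ((ℤ → Fin 2) × (ℤ → ℤ) × (ℤ → A) × (ℤ → A')) :=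
    (fibSystem.carrier ×ˢ S ×ˢ Set.univ) ∩
      ({q | Tiles B q.1 q.2.1 q.2.2.1} ∩ {q | Tiles B' q.1 q.2.1 q.2.2.2})
  have hT : IsCompact T := by
    refine (hX.prod (hS.prod isCompact_univ)).inter_right (IsClosed.inter ?_ ?_)
    · exact isClosed_setOf_tiles B (by fun_prop) (by fun_prop) (by fun_prop)
    · exact isClosed_setOf_tiles B' (by fun_prop) (by fun_prop) (by fun_prop)
  have e : jointTilings B B' = (fun q => q.2.2) '' T := by
    ext q
    constructor
    · rintro ⟨x, hx, s, h1, h2⟩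
      obtain ⟨j, hj⟩ := h1.exists_normalized hB hc
      exact ⟨(shift j x, fun k => s (j + k), q), ⟨⟨fibSystem.mapsTo j hx, fun k _ => hj k, trivial⟩,
        h1.reindex j, h2.reindex j⟩, rfl⟩
    · rintro ⟨⟨x, s, q⟩, ⟨⟨hx, -, -⟩, h1, h2⟩, rfl⟩
      exact ⟨x, hx, s, h1, h2⟩
  rw [e]
  exact hT.image (by fun_prop)

/-- Every sequence of the Fibonacci system is composed of the words `φ ^ m (0)` and `φ ^ m (1)`,
in the order given by a sequence of the system. -/
theorem exists_tiles_iterate {z : ℤ → Fin 2} (hz : z ∈ fibSystem.carrier) (m : ℕ) :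
    ∃ x ∈ fibSystem.carrier, ∃ s, Tiles (fun a => fibSubst^[m] [a]) x s z := by
  let B : Fin 2 → List (Fin 2) := fun a => fibSubst^[m] [a]
  have hp : fibPoint ∈ fibSystem.carrier := subset_closure ⟨0, by funext h; simp [shift_apply]⟩
  obtain ⟨s, z₀, h₀⟩ := exists_tiles (B := B) (iterate_ne_nil m) fibPoint
  -- Minimality takes the place of desubstitution: the sequences tiled in this way form a closed
  -- invariant set that contains the point `z₀` of the system.
  have hsub := fibSystem_subset (Z := Prod.fst '' jointTilings B B)
    ((isCompact_jointTilings (iterate_ne_nil m)).image continuous_fst).isClosed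
    (by
      rintro _ ⟨q, hq, rfl⟩ g
      exact ⟨_, shift_mem_jointTilings hq g, rfl⟩)
    (mem_fibSystem_of_tiles hp h₀) ⟨(z₀, z₀), ⟨fibPoint, hp, s, h₀, h₀⟩, rfl⟩
  obtain ⟨q, ⟨x, hx, s, h, -⟩, rfl⟩ := hsub hz
  exact ⟨x, hx, s, h⟩

end Compactness

/-! ### Uniqueness of Fibonacci tilings -/

section Uniqueness

theorem eq_of_steps {f g d : ℤ → ℤ} (hf : ∀ k, f (k + 1) = f k + d k)
    (hg : ∀ k, g (k + 1) = g k + d k) {k₀ : ℤ} (h : f k₀ = g k₀) : f = g := by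
  have h1 : ∀ k, f (k₀ + k) = g (k₀ + k) := by
    intro k
    induction k using Int.induction_on with
    | zero => simpa using h
    | succ k ih => rw [← add_assoc, hf, hg, ih]
    | pred k ih =>
      have h2 := hf (k₀ + (-k - 1))
      have h3 := hg (k₀ + (-k - 1))
      have e : k₀ + (-(k : ℤ) - 1) + 1 = k₀ + -k := by ring
      rw [e] at h2 h3
      omega
  funext k
  simpa using h1 (k - k₀)

variable {A : Type*} {B : Fin 2 → List A} {p : ℕ}

theorem Tiles.step_cases (h0 : (B 0).length = Nat.fib (p + 1)) (h1 : (B 1).length = Nat.fib p)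
    {x : ℤ → Fin 2} {s : ℤ → ℤ} {y : ℤ → A} (h : Tiles B x s y) (k : ℤ) :
    s (k + 1) = s k + Nat.fib p ∨ s (k + 1) = s k + Nat.fib (p + 1) := by
  have := (h k).1
  rcases fin_two_cases (x k) with e | e <;> rw [e] at this <;> omega

/-- If all pieces begin with a word that is constant, then the sequence is constant. -/
theorem eq_of_cuts_of_prefix_constant {y P : ℤ → A} {s : ℤ → ℤ} {l : ℤ}
    (hlt : ∀ k, s k < s (k + 1)) (hl : ∀ k, s (k + 1) ≤ s k + l)
    (hP : ∀ k i, 0 ≤ i → i < l → y (s k + i) = P i)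
    (hc : ∀ i, 0 ≤ i → i < l → P i = P 0) (t : ℤ) : y t = y 0 := by
  have key : ∀ t, y t = P 0 := by
    intro t
    obtain ⟨k, hk, hk'⟩ := exists_between_cuts hlt t
    have hl := hl k
    have := hP k (t - s k) (by omega) (by omega)
    rw [add_sub_cancel, hc _ (by omega) (by omega)] at this
    exact this
  rw [key t, key 0]

/-- A non-constant sequence is a concatenation of two blocks with consecutive Fibonacci numbers
as lengths, in the order given by a sequence of the Fibonacci system, in at most one way. -/
theorem tiles_unique (h0 : (B 0).length = Nat.fib (p + 1)) (h1 : (B 1).length = Nat.fib p)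
    {x x' : ℤ → Fin 2} {s s' : ℤ → ℤ} {y : ℤ → A}
    (hx : x ∈ fibSystem.carrier) (hx' : x' ∈ fibSystem.carrier)
    (h : Tiles B x s y) (h' : Tiles B x' s' y) (hy : ∃ t, y t ≠ y 0) :
    ∃ j, x' = shift j x ∧ s' = fun k => s (j + k) := by
  -- Both tilings are grouped into words of level 4, the first level at which the common prefix
  -- meets the length bounds of `cuts_unique` for every `p`.
  obtain ⟨u, hu, r, hr⟩ := exists_tiles_iterate hx 4
  obtain ⟨u', hu', r', hr'⟩ := exists_tiles_iterate hx' 4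
  have hC : Tiles (level B 4) u (fun k => s (r k)) y := hr.comp h
  have hC' : Tiles (level B 4) u' (fun k => s' (r' k)) y := hr'.comp h'
  obtain ⟨hl0, hl1⟩ := length_level h0 h1 4
  obtain ⟨z, hz, hz0, hz1⟩ := exists_common_prefix B 4
  rw [hl0, hl1, h0, h1] at hz
  have hread := hC.reads_common_prefix (eq_zero_or_succ_eq_zero hu) hz0 hz1
  have hP : ∀ k i : ℤ, 0 ≤ i → i < z.length → y (s (r k) + i) = y (s (r 0) + i) := by
    intro k i hi hi'
    lift i to ℕ using hi
    rw [hread k i (by omega), hread 0 i (by omega)]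
  have f2 := Nat.fib_add_two (n := p)
  have f3 := Nat.fib_add_two (n := p + 1)
  have f4 := Nat.fib_add_two (n := p + 2)
  have f5 := Nat.fib_add_two (n := p + 3)
  simp only [add_assoc, Nat.reduceAdd] at f2 f3 f4 f5 hz hl0
  have fpos : 0 < Nat.fib (p + 1) := Nat.fib_pos.2 (by omega)
  have hw0 : level B 4 0 <+: z := List.prefix_of_prefix_length_le (List.prefix_append ..) hz0
    (by omega)
  have hw1 : level B 4 1 <+: z := by
    refine List.IsPrefix.trans ?_ hw0
    rw [level_succ_zero, level_succ_one]
    exact List.prefix_append ..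
  have hcop : Int.gcd (Nat.fib (p + 4)) (Nat.fib (p + 4 + 1)) = 1 := by
    rw [Int.gcd_natCast_natCast]; exact Nat.fib_coprime_fib_succ _
  have hsteps := hC.step_cases (p := p + 4) hl0 hl1
  have hsteps' := hC'.step_cases (p := p + 4) hl0 hl1
  simp only [add_assoc, Nat.reduceAdd] at hcop hsteps hsteps'
  obtain ⟨i, hi0, hi1⟩ := exists_zero_one hu
  obtain ⟨j, hj⟩ := cuts_unique (y := y) (P := fun i => y (s (r 0) + i)) (s := fun k => s (r k))
    (s' := fun k => s' (r' k)) (l := z.length) hcop (by omega) (by omega) (by omega) (by omega)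
    hsteps ⟨i + 1, by have := (hC (i + 1)).1; rw [hi1, hl1] at this; exact this⟩
    ⟨i, by have := (hC i).1; rw [hi0, hl0] at this; exact this⟩ hP hsteps'
    (by
      intro k i hi hi'
      lift i to ℕ using hi
      obtain ⟨e, hk⟩ := hC' k
      beta_reduce at e hi'
      rcases fin_two_cases (u' k) with e' | e' <;> rw [e'] at hk e
      · have hi'' : i < (level B 4 0).length := by omega
        rw [hk i hi'', hread 0 i (hi''.trans_le hw0.length_le), hw0.getElem]
      · have hi'' : i < (level B 4 1).length := by omega
        rw [hk i hi'', hread 0 i (hi''.trans_le hw1.length_le), hw1.getElem])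
    (by
      by_contra hcon
      push Not at hcon
      obtain ⟨t, ht⟩ := hy
      exact ht (eq_of_cuts_of_prefix_constant (P := fun i => y (s (r 0) + i))
        (s := fun k => s (r k)) (l := z.length)
        (fun k => by rcases hsteps k with h | h <;> omega)
        (fun k => by rcases hsteps k with h | h <;> omega) hP hcon t))
  have hcut : (fun k => s' (r' k)) = fun k => s (r (j + k)) := by
    funext k; rw [add_comm j]; exact hj k
  rw [hcut] at hC'
  have huu : u' = shift j u :=
    hC'.eq_of_cuts_eq (by omega) (hC.reindex j)
  have hrr := hr.reindex j
  rw [← huu] at hrr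
  -- Translated by `r j - r' 0`, the grouping of `x` agrees with that of `x'` at index `0`. Their
  -- steps coincide, so the cuts agree everywhere and `x'` is the shifted `x`.
  have hr'' := hrr.shift (r j - r' 0)
  have er : r' = fun k => r (j + k) - (r j - r' 0) :=
    eq_of_steps (fun k => (hr' k).1) (fun k => (hr'' k).1) (k₀ := 0) (by simp)
  rw [← er] at hr''
  have exx := hr'.ext (iterate_ne_nil 4) hr''
  refine ⟨r j - r' 0, exx, ?_⟩
  have hre := h.reindex (r j - r' 0)
  rw [← exx] at hre
  refine eq_of_steps (fun k => (h' k).1) (fun k => (hre k).1) (k₀ := r' 0) ?_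
  have := congrFun hcut 0
  simpa using this

/-- Replacing the blocks of a non-constant `y` gives a result that depends only on `y`; this is the
injectivity of the projections of `jointTilings`. -/
theorem Tiles.transfer {A' : Type*} {B' : Fin 2 → List A'}
    (h0 : (B 0).length = Nat.fib (p + 1)) (h1 : (B 1).length = Nat.fib p)
    (hB' : ∀ a, B' a ≠ []) {x x' : ℤ → Fin 2} {s s' : ℤ → ℤ} {y : ℤ → A} {z z' : ℤ → A'}
    (hx : x ∈ fibSystem.carrier) (hx' : x' ∈ fibSystem.carrier)
    (h : Tiles B x s y) (h' : Tiles B x' s' y) (hy : ∃ t, y t ≠ y 0)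
    (hz : Tiles B' x s z) (hz' : Tiles B' x' s' z') : z = z' := by
  obtain ⟨j, rfl, rfl⟩ := tiles_unique h0 h1 hx hx' h h' hy
  exact (hz.reindex j).ext hB' hz'

end Uniqueness

/-! ### Continuous maps on subshifts are locally determined -/

section Radius

/-- If no radius worked, the pairs that agree on `[-L, L]` but have different images would form
decreasing non-empty compact sets; a common point would be a diagonal pair with two images. -/
theorem exists_radius {A B : Type*} [Finite A] [TopologicalSpace A] [DiscreteTopology A]
    [TopologicalSpace B] [DiscreteTopology B] (X : Subshift A ℤ)
    {g : X.carrier → B} (hg : Continuous g) :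
    ∃ L : ℕ, ∀ x x' : X.carrier, (∀ i : ℤ, |i| ≤ L → x.1 i = x'.1 i) → g x = g x' := by
  by_contra hcon
  push Not at hcon
  have : CompactSpace X.carrier := isCompact_iff_compactSpace.1 X.isClosed.isCompact
  let K : ℕ → Set (X.carrier × X.carrier) := fun L =>
    {q | ∀ i : ℤ, |i| ≤ L → q.1.1 i = q.2.1 i} ∩ {q | g q.1 ≠ g q.2}
  have hK : ∀ L, IsClosed (K L) := by
    intro L
    refine IsClosed.inter ?_ ?_
    · simp only [Set.ofPred_forall]
      refine isClosed_iInter fun i => isClosed_iInter fun _ => isClosed_eq ?_ ?_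
      · exact (continuous_apply i).comp (continuous_subtype_val.comp continuous_fst)
      · exact (continuous_apply i).comp (continuous_subtype_val.comp continuous_snd)
    · exact (isClosed_discrete {q : B × B | q.1 ≠ q.2}).preimage
        (f := fun q : X.carrier × X.carrier => (g q.1, g q.2)) (by fun_prop)
  obtain ⟨q, hq⟩ := IsCompact.nonempty_iInter_of_sequence_nonempty_isCompact_isClosed K
    (fun L q hq => ⟨fun i hi => hq.1 i (hi.trans (by push_cast; omega)), hq.2⟩)
    (fun L => by
      obtain ⟨x, x', h1, h2⟩ := hcon L
      exact ⟨(x, x'), h1, h2⟩) (hK 0).isCompact hK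
  rw [Set.mem_iInter] at hq
  refine (hq 0).2 (congrArg g (Subtype.ext (funext fun i => (hq i.natAbs).1 i ?_)))
  exact (Int.abs_eq_natAbs i).le

end Radius

/-- A constant sequence can also be cut into copies of `B 0` alone, and `…000…` is not in the
system. -/
theorem exists_ne_of_forall_tiles_mem {A : Type*} {B : Fin 2 → List A} {y : ℤ → A}
    (h1 : ∃ x, IsConcatenation B x y)
    (h2 : ∀ x, IsConcatenation B x y → x ∈ fibSystem.carrier) : ∃ t, y t ≠ y 0 := by
  by_contra hcon
  push Not at hcon
  obtain ⟨x, s, hs⟩ := h1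
  obtain ⟨i, hi, -⟩ := exists_zero_one (h2 x ⟨s, hs⟩)
  have hB0 : Reads y (s i) (B (x i)) := (hs i).2
  rw [hi] at hB0
  have : Tiles B (fun _ => 0) (fun k => k * (B 0).length) y := fun k =>
    ⟨by ring, hB0.congr fun j _ => by rw [hcon, ← hcon (s i + j)]⟩
  obtain ⟨j, -, hj⟩ := exists_zero_one (h2 _ (isConcatenation_iff.2 ⟨_, this⟩))
  exact absurd hj (by decide)

/-! ### From blocks to a conjugacy and back -/

section Conjugacy

variable {A : Type*} [TopologicalSpace A] [DiscreteTopology A] {Y : Subshift A ℤ}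

theorem topConjugate_of_isConcatenation [Finite A] (hY : Y.carrier.Nonempty) {m : ℕ} {B : Fin 2 → List A}
    (h0 : (B 0).length = Nat.fib (m + 2)) (h1 : (B 1).length = Nat.fib (m + 1))
    (hex : ∀ y ∈ Y.carrier, ∃ x, IsConcatenation B x y)
    (hmem : ∀ y ∈ Y.carrier, ∀ x, IsConcatenation B x y → x ∈ fibSystem.carrier) :
    TopConjugate Y fibSystem := by
  have hB : ∀ a, B a ≠ [] := fun a => by
    rw [← List.length_pos_iff]
    rcases fin_two_cases a with rfl | rfl
    · rw [h0]; exact Nat.fib_pos.2 (by omega)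
    · rw [h1]; exact Nat.fib_pos.2 (by omega)
  let C : Fin 2 → List (Fin 2) := fun a => fibSubst^[m] [a]
  have hC : ∀ a, C a ≠ [] := iterate_ne_nil m
  have hC0 : (C 0).length = Nat.fib (m + 2) := (length_fibSubst_iterate m).1
  have hC1 : (C 1).length = Nat.fib (m + 1) := (length_fibSubst_iterate m).2
  have hCB : ∀ a, (C a).length = (B a).length := fun a => by
    rcases fin_two_cases a with rfl | rfl
    · rw [hC0, h0]
    · rw [hC1, h1]
  let G := jointTilings C B
  have hG : IsCompact G := isCompact_jointTilings hC
  have hGX : ∀ q ∈ G, q.1 ∈ fibSystem.carrier := by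
    rintro q ⟨x, hx, s, hs, -⟩
    exact mem_fibSystem_of_tiles hx hs
  have exY : ∀ y ∈ Y.carrier, ∃ z, (z, y) ∈ G := by
    intro y hy
    obtain ⟨x, s, hs⟩ := hex y hy
    obtain ⟨z, hz⟩ := exists_tiles_of_cuts (x := x) (s := s) hC fun k => by rw [(hs k).1, hCB]
    exact ⟨z, x, hmem y hy x ⟨s, hs⟩, s, hz, hs⟩
  -- The points of `X_φ` with a partner in `Y` form a non-empty closed invariant set, hence all of
  -- `X_φ`.
  have exX : ∀ z ∈ fibSystem.carrier, ∃ y ∈ Y.carrier, (z, y) ∈ G := by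
    obtain ⟨y₀, hy₀⟩ := hY
    obtain ⟨z₀, hz₀⟩ := exY y₀ hy₀
    have hsub := fibSystem_subset (Z := Prod.fst '' (G ∩ Prod.snd ⁻¹' Y.carrier))
      ((hG.inter_right (Y.isClosed.preimage continuous_snd)).image continuous_fst).isClosed
      (by
        rintro _ ⟨q, ⟨hq, hqY⟩, rfl⟩ g
        exact ⟨_, ⟨shift_mem_jointTilings hq g, Y.mapsTo g hqY⟩, rfl⟩)
      (hGX _ hz₀) ⟨_, ⟨hz₀, hy₀⟩, rfl⟩
    intro z hz
    obtain ⟨⟨z, y⟩, ⟨hq, hy⟩, rfl⟩ := hsub hz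
    exact ⟨y, hy, hq⟩
  have uniqX : ∀ z y y', (z, y) ∈ G → (z, y') ∈ G → y = y' := by
    rintro z y y' ⟨x, hx, s, hs, ht⟩ ⟨x', hx', s', hs', ht'⟩
    obtain ⟨i, hi, hi'⟩ := exists_zero_one (hGX (z, y) ⟨x, hx, s, hs, ht⟩)
    refine hs.transfer hC0 hC1 hB hx hx' hs' ?_ ht ht'
    by_contra hcon
    push Not at hcon
    dsimp only at hi hi' hcon
    rw [hcon] at hi hi'
    exact absurd (hi.symm.trans hi') (by decide)
  have uniqY : ∀ y ∈ Y.carrier, ∀ z z', (z, y) ∈ G → (z', y) ∈ G → z = z' := by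
    rintro y hy z z' ⟨x, hx, s, hs, ht⟩ ⟨x', hx', s', hs', ht'⟩
    exact ht.transfer h0 h1 hC hx hx' ht'
      (exists_ne_of_forall_tiles_mem (hex y hy) (hmem y hy)) hs hs'
  -- The first coordinate has some partner in `Y`, and by `uniqX` it has no other partner.
  have hGY : ∀ q ∈ G, q.2 ∈ Y.carrier := by
    intro q hq
    obtain ⟨y, hy, h⟩ := exX q.1 (hGX q hq)
    rwa [← uniqX q.1 y q.2 h hq]
  have : CompactSpace G := isCompact_iff_compactSpace.1 hG
  let f₁ : G → fibSystem.carrier := fun q => ⟨q.1.1, hGX _ q.2⟩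
  let f₂ : G → Y.carrier := fun q => ⟨q.1.2, hGY _ q.2⟩
  have c₁ : Continuous f₁ := by fun_prop
  have c₂ : Continuous f₂ := by fun_prop
  have b₁ : Function.Bijective f₁ := by
    refine ⟨fun q q' h => ?_, fun z => ?_⟩
    · have h : q.1.1 = q'.1.1 := congrArg Subtype.val h
      refine Subtype.ext (Prod.ext h (uniqX q.1.1 _ _ q.2 ?_))
      rw [h]; exact q'.2
    · obtain ⟨y, -, h⟩ := exX z.1 z.2
      exact ⟨⟨_, h⟩, rfl⟩
  have b₂ : Function.Bijective f₂ := by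
    refine ⟨fun q q' h => ?_, fun y => ?_⟩
    · have h : q.1.2 = q'.1.2 := congrArg Subtype.val h
      refine Subtype.ext (Prod.ext (uniqY q.1.2 (hGY _ q.2) _ _ q.2 ?_) h)
      rw [h]; exact q'.2
    · obtain ⟨z, h⟩ := exY y.1 y.2
      exact ⟨⟨_, h⟩, rfl⟩
  let e₁ : G ≃ₜ fibSystem.carrier :=
    Continuous.homeoOfEquivCompactToT2 (f := Equiv.ofBijective f₁ b₁) c₁
  let e₂ : G ≃ₜ Y.carrier := Continuous.homeoOfEquivCompactToT2 (f := Equiv.ofBijective f₂ b₂) c₂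
  refine ⟨e₂.symm.trans e₁, fun y => ?_⟩
  obtain ⟨q, rfl⟩ := e₂.surjective y
  have hq : e₂.symm (shiftMap Y (e₂ q)) = ⟨_, shift_mem_jointTilings q.2 1⟩ := by
    rw [Homeomorph.symm_apply_eq]; rfl
  simp only [Homeomorph.trans_apply, hq, Homeomorph.symm_apply_apply]
  rfl

theorem semiconj_shift {A₁ A₂ : Type*} [TopologicalSpace A₁] [TopologicalSpace A₂]
    {X : Subshift A₁ ℤ} {Z : Subshift A₂ ℤ} {θ : X.carrier → Z.carrier}
    (hθ : Function.Semiconj θ (shiftMap X) (shiftMap Z)) (t : ℤ) (x x' : X.carrier)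
    (h : x'.1 = shift t x.1) : (θ x').1 = shift t (θ x).1 := by
  have hstep : ∀ x : X.carrier, (θ (shiftMap X x)).1 = shift 1 (θ x).1 :=
    fun x => congrArg Subtype.val (hθ x)
  induction t using Int.induction_on generalizing x x' with
  | zero =>
    obtain rfl : x' = x := Subtype.ext (by simpa using h)
    simp
  | succ k ih =>
    have e : x' = shiftMap X ⟨shift (k : ℤ) x.1, X.mapsTo k x.2⟩ :=
      Subtype.ext (h.trans (shift_add _ _ _))
    rw [e, hstep, ih x ⟨shift (k : ℤ) x.1, X.mapsTo k x.2⟩ rfl, shift_add]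
  | pred k ih =>
    have e : (shiftMap X x').1 = shift (-(k : ℤ)) x.1 := by
      rw [show (-(k : ℤ)) = -k - 1 + 1 by ring, shift_add, ← h]; rfl
    have h1 := ih x _ e
    rw [hstep] at h1
    rw [sub_eq_add_neg, shift_add, ← h1, ← shift_add]
    simp

theorem exists_blocks_of_topConjugate (h : TopConjugate Y fibSystem) :
    ∃ m : ℕ, 1 ≤ m ∧ ∃ B : Fin 2 → List A,
      (B 0).length = Nat.fib (m + 2) ∧ (B 1).length = Nat.fib (m + 1) ∧
      (∀ y ∈ Y.carrier, ∃ x, IsConcatenation B x y) ∧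
      ∀ y ∈ Y.carrier, ∀ x, IsConcatenation B x y → x ∈ fibSystem.carrier := by
  obtain ⟨ψ, hψ⟩ := h
  let θ := ψ.symm
  have hθ : Function.Semiconj θ (shiftMap fibSystem) (shiftMap Y) := fun x => by
    rw [ψ.symm_apply_eq, hψ, ψ.apply_symm_apply]
  obtain ⟨L, hL⟩ := exists_radius fibSystem (g := fun x => (θ x).1 0)
    ((continuous_apply 0).comp (continuous_subtype_val.comp θ.continuous))
  have local_rule : ∀ (x x' : fibSystem.carrier) (t t' : ℤ),
      (∀ i : ℤ, |i| ≤ L → x.1 (t + i) = x'.1 (t' + i)) → (θ x).1 t = (θ x').1 t' := by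
    intro x x' t t' hi
    have h := hL ⟨shift t x.1, fibSystem.mapsTo t x.2⟩ ⟨shift t' x'.1, fibSystem.mapsTo t' x'.2⟩
      (fun i h => by simpa [shift_apply] using hi i h)
    have e1 := congrFun (semiconj_shift hθ t x ⟨shift t x.1, fibSystem.mapsTo t x.2⟩ rfl) 0
    have e2 := congrFun
      (semiconj_shift hθ t' x' ⟨shift t' x'.1, fibSystem.mapsTo t' x'.2⟩ rfl) 0
    simp only [shift_apply, add_zero] at e1 e2
    rw [← e1, ← e2]
    exact h
  -- `m ≤ Nat.fib (m + 1)`, so this `m` leaves the common prefix long enough for `cuts_unique` after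
  -- the loss of `L` letters at each end.
  obtain ⟨m, hm⟩ : ∃ m, m = 4 * L + 9 := ⟨_, rfl⟩
  have fm := Nat.le_fib_add_one (m + 1)
  have f3 := Nat.fib_add_two (n := m + 1)
  have f4 := Nat.fib_add_two (n := m + 2)
  have flt := Nat.fib_lt_fib_succ (n := m + 1) (by omega)
  simp only [add_assoc, Nat.reduceAdd] at f3 f4 flt
  obtain ⟨z, hz, hz0, hz1⟩ := exists_common_prefix (fun b : Fin 2 => [b]) (m + 1)
  have hlev : level (fun b : Fin 2 => [b]) (m + 1) = fun a => fibSubst^[m + 1] [a] := by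
    funext a; exact level_singleton _ _
  have hlen0 : (fibSubst^[m + 1] [0]).length = Nat.fib (m + 3) := (length_fibSubst_iterate _).1
  have hlen1 : (fibSubst^[m + 1] [1]).length = Nat.fib (m + 2) := (length_fibSubst_iterate _).2
  have hzlen : z.length + 2 = Nat.fib (m + 3) + Nat.fib (m + 2) := by
    rw [level_singleton, level_singleton, hlen0, hlen1] at hz
    exact hz
  have hread : ∀ {x s x₀}, x ∈ fibSystem.carrier → Tiles (fun a => fibSubst^[m + 1] [a]) x s x₀ →
      ∀ k, Reads x₀ (s k) z := by
    intro x s x₀ hx h k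
    rw [← hlev] at h
    exact h.reads_common_prefix (eq_zero_or_succ_eq_zero hx) hz0 hz1 k
  let p : fibSystem.carrier := ⟨fibPoint, subset_closure ⟨0, by simp⟩⟩
  obtain ⟨xp, hxp, sp, hsp⟩ := exists_tiles_iterate p.2 (m + 1)
  -- The code looks `L` letters to each side, so its values are determined by `z` from `L` letters
  -- after a cut up to `L` letters before the end of `z`.
  let P : ℤ → A := fun i => (θ p).1 (sp 0 + L + i)
  have hP : ∀ (x₀ : fibSystem.carrier) (x s), x ∈ fibSystem.carrier →
      Tiles (fun a => fibSubst^[m + 1] [a]) x s x₀.1 →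
      ∀ k i, 0 ≤ i → i < (z.length : ℤ) - 2 * L → (θ x₀).1 (s k + L + i) = P i := by
    intro x₀ x s hx h k i hi hi'
    refine local_rule _ _ _ _ fun j hj => ?_
    obtain ⟨hj1, hj2⟩ := abs_le.1 hj
    have e1 := hread hx h k (L + i + j).toNat (by omega)
    have e2 := hread hxp hsp 0 (L + i + j).toNat (by omega)
    have e : ((L + i + j).toNat : ℤ) = L + i + j := Int.toNat_of_nonneg (by omega)
    rw [e] at e1 e2
    rw [show s k + L + i + j = s k + (L + i + j) by ring,
      show sp 0 + L + i + j = sp 0 + (L + i + j) by ring, e1, e2]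
  let B : Fin 2 → List A := fun a =>
    List.ofFn fun i : Fin (fibSubst^[m + 1] [a]).length => P (i : ℕ)
  have hB0 : (B 0).length = Nat.fib (m + 2 + 1) := List.length_ofFn.trans hlen0
  have hB1 : (B 1).length = Nat.fib (m + 2) := List.length_ofFn.trans hlen1
  have hBle : ∀ a, ((B a).length : ℤ) ≤ (z.length : ℤ) - 2 * L := fun a => by
    rcases fin_two_cases a with rfl | rfl
    · rw [hB0]; simp only [add_assoc, Nat.reduceAdd]; omega
    · rw [hB1]; omega
  have htile : ∀ (x₀ : fibSystem.carrier) (x s), x ∈ fibSystem.carrier →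
      Tiles (fun a => fibSubst^[m + 1] [a]) x s x₀.1 →
      Tiles B x (fun k => s k + L) (θ x₀).1 := by
    intro x₀ x s hx h k
    refine ⟨by simp only [(h k).1, B, List.length_ofFn]; ring, ?_⟩
    refine (reads_ofFn_iff (f := fun i : ℕ => P i)).2 fun i hi => ?_
    have := hBle (x k)
    rw [List.length_ofFn] at this
    exact hP x₀ x s hx h k i (by omega) (by omega)
  refine ⟨m + 1, by omega, B, hB0, hB1, fun y hy => ?_, fun y hy x' hx' => ?_⟩
  · obtain ⟨x, hx, s, hs⟩ := exists_tiles_iterate (ψ ⟨y, hy⟩).2 (m + 1)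
    have := htile _ x s hx hs
    rw [ψ.symm_apply_apply] at this
    exact ⟨x, isConcatenation_iff.2 ⟨_, this⟩⟩
  · obtain ⟨s', hs'⟩ := hx'
    obtain ⟨x₀, hx₀⟩ := θ.surjective ⟨y, hy⟩
    obtain ⟨x, hx, s, hs⟩ := exists_tiles_iterate x₀.2 (m + 1)
    have hy' : (θ x₀).1 = y := by rw [hx₀]
    have ht := htile x₀ x s hx hs
    have hPs := hP x₀ x s hx hs
    rw [hy'] at ht hPs
    have hsteps := ht.step_cases hB0 hB1
    have hsteps' := Tiles.step_cases hB0 hB1 hs'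
    have hcop : Int.gcd (Nat.fib (m + 2)) (Nat.fib (m + 2 + 1)) = 1 := by
      rw [Int.gcd_natCast_natCast]; exact Nat.fib_coprime_fib_succ _
    obtain ⟨i, hi0, hi1⟩ := exists_zero_one hx
    simp only [add_assoc, Nat.reduceAdd] at hcop hsteps hsteps' hB0
    simp only [← add_assoc] at hsteps
    obtain ⟨j, hj⟩ := cuts_unique (y := y) (P := P) (s := fun k => s k + L) (s' := s')
      (l := (z.length : ℤ) - 2 * L) hcop (by omega) (by omega) (by omega) (by omega)
      hsteps ⟨i + 1, by have := (ht (i + 1)).1; rw [hi1, hB1] at this; exact this⟩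
      ⟨i, by have := (ht i).1; rw [hi0, hB0] at this; exact this⟩ hPs hsteps'
      (by
        intro k i hi hi'
        lift i to ℕ using hi
        have hk := hs' k
        have := (reads_ofFn_iff (f := fun i : ℕ => P i)).1 hk.2 i
        refine this ?_
        have hk1 := hk.1
        rw [List.length_ofFn] at hk1
        omega)
      (by
        by_contra hcon
        push Not at hcon
        -- A constant `P` would make `y` a fixed point of the shift, and hence also `x₀`, in which
        -- `01` occurs.
        have hconst := eq_of_cuts_of_prefix_constant (P := P)
          (s := fun k => s k + L) (l := (z.length : ℤ) - 2 * L)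
          (fun k => by rcases hsteps k with h | h <;> omega)
          (fun k => by rcases hsteps k with h | h <;> omega) hPs hcon
        have hfix : shiftMap Y (θ x₀) = θ x₀ := Subtype.ext (by
          change shift 1 (θ x₀).1 = (θ x₀).1
          rw [hy']
          funext t
          rw [shift_apply, hconst, ← hconst t])
        rw [← hθ x₀] at hfix
        have hfix' : shift 1 x₀.1 = x₀.1 := congrArg Subtype.val (θ.injective hfix)
        obtain ⟨i, hi, hi'⟩ := exists_zero_one x₀.2
        have := congrFun hfix' i
        rw [shift_apply, add_comm, hi, hi'] at this
        exact absurd this (by decide))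
    have hcut : s' = fun k => s (j + k) + L := by
      funext k; rw [hj k, add_comm j]
    have hs'' : Tiles B x' s' y := hs'
    rw [hcut] at hs''
    rw [hs''.eq_of_cuts_eq (by omega) (ht.reindex j)]
    exact fibSystem.mapsTo j hx

end Conjugacy

end FibonacciClass

theorem theorem2 {A : Type*} [Finite A] [TopologicalSpace A] [DiscreteTopology A]
    (Y : SymbolicDynamics.FullShift.Subshift A ℤ) (hY : Y.carrier.Nonempty) :
    FibonacciClass.TopConjugate Y FibonacciClass.fibSystem ↔
      ∃ n : ℕ, 3 ≤ n ∧ ∃ B : Fin 2 → List A,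
        (B 0).length = Nat.fib n ∧ (B 1).length = Nat.fib (n - 1) ∧
        (∀ y ∈ Y.carrier, ∃ x : ℤ → Fin 2, FibonacciClass.IsConcatenation B x y) ∧
        (∀ y ∈ Y.carrier, ∀ x : ℤ → Fin 2,
          FibonacciClass.IsConcatenation B x y → x ∈ FibonacciClass.fibSystem.carrier) := by
  constructor
  · intro h
    obtain ⟨m, hm, B, h0, h1, h2, h3⟩ := FibonacciClass.exists_blocks_of_topConjugate h
    exact ⟨m + 2, by omega, B, h0, h1, h2, h3⟩
  · rintro ⟨n, hn, B, h0, h1, h2, h3⟩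
    obtain ⟨m, rfl⟩ : ∃ m, n = m + 2 := ⟨n - 2, by omega⟩
    exact FibonacciClass.topConjugate_of_isConcatenation hY h0 h1 h2 h3
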